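/- Let $n\ge 1$ and let $A\in M_n(\mathbb{Z})$ be an invertible matrix (i.e. $\det A\neq 0$) such that $x\mapsto A^{-1}x$ is a contracting similarity of $\mathbb{R}^n$ for the Euclidean distance, that is, $\|A^{-1}x-A^{-1}y\|=c\,\|x-y\|$ for all $x,y$ and some $c\in(0,1)$. Let $D\subset\mathbb{Z}^n$ be a subset of a complete residue system mod $A$, i.e. of a set $\mathcal{D}\subset\mathbb{Z}^n$ for which the canonical map $\mathcal{D}\to\mathbb{Z}^n/A\mathbb{Z}^n$ is bijective. For a finite set $E\subset\mathbb{Z}^n$, an $(A,E)$-representation of $x\in\mathbb{R}^n$ is a sequence $(e_j)_{j\ge1}$ in $E$ with $x=\sum_{j=1}^\infty A^{-j}e_j$, and $T_{A,E}$ is the set of all $x\in\mathbb{R}^n$ that have an $(A,E)$-representation (equivalently, for $E\neq\emptyset$, the attractor of the maps $x\mapsto A^{-1}(x+e)$, $e\in E$). Suppose that $\alpha\in T_{A,D-D}$ has a unique $(A,D-D)$-representation $(\alpha_j)_{j\ge1}$, and that there exist an integer $p\ge1$, finite sets $U_1,\dots,U_p,V_1,\dots,V_p\subset\mathbb{Z}^n$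 and a sequence $(\beta_j)_{j\ge1}$ in $D$ such that $$\bigl((D\cap(D+\alpha_j))-\beta_j\bigr)_{j\ge1}=(U_\ell)_{\ell=1}^p\,\overline{(U_\ell+V_\ell)_{\ell=1}^p},$$ that is, the sequence of sets on the left consists of $U_1,\dots,U_p$ followed by the block $U_1+V_1,\dots,U_p+V_p$ repeated forever. Then $$\dim_H\bigl(T_{A,D}\cap(T_{A,D}+\alpha)\bigr)=\frac{\log\left(\prod_{\ell=1}^p|U_\ell+V_\ell|\right)}{p\,\log\left(|\det A|^{1/n}\right)}.$$ -/

import Mathlib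

open scoped Pointwise

namespace SelfAffine

/-- `f` is a similarity with contraction coefficient `c ∈ (0, 1)`. -/
def IsSimilarity {X : Type*} [PseudoMetricSpace X] (f : X → X) : Prop :=
  ∃ c : ℝ, 0 < c ∧ c < 1 ∧ ∀ x y : X, dist (f x) (f y) = c * dist x y

/-- An integer matrix, viewed as a real matrix. -/
def realMat {n : ℕ} (A : Matrix (Fin n) (Fin n) ℤ) : Matrix (Fin n) (Fin n) ℝ :=
  A.map (fun z : ℤ => (z : ℝ))

/-- An integer vector, viewed as a point of Euclidean space. -/
def realVec {n : ℕ} (d : Fin n → ℤ) : EuclideanSpace ℝ (Fin n) :=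
  WithLp.toLp 2 (fun i => (d i : ℝ))

/-- Multiplication by the inverse of `A` on Euclidean space. -/
noncomputable def invMap {n : ℕ} (A : Matrix (Fin n) (Fin n) ℤ) :
    EuclideanSpace ℝ (Fin n) →ₗ[ℝ] EuclideanSpace ℝ (Fin n) :=
  Matrix.toEuclideanLin (realMat A)⁻¹

/-- The set `R` is a complete residue system mod `A`: the canonical map from `R` to
`ℤⁿ / A ℤⁿ` is bijective. -/
def IsCompleteResidueSystem {n : ℕ} (A : Matrix (Fin n) (Fin n) ℤ)
    (R : Set (Fin n → ℤ)) : Prop :=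
  Function.Bijective
    (fun d : R => (Submodule.Quotient.mk (d : Fin n → ℤ) :
      (Fin n → ℤ) ⧸ LinearMap.range (Matrix.mulVecLin A)))

/-- The digit sequence `d 0, d 1, d 2, …` (in the usual indexing `d₁, d₂, d₃, …`) is an
`(A, D)`-representation of `x`: all digits lie in `D` and `x = ∑_{j ≥ 1} A⁻ʲ dⱼ`. -/
def IsRepresentation {n : ℕ} (A : Matrix (Fin n) (Fin n) ℤ) (D : Finset (Fin n → ℤ))
    (d : ℕ → Fin n → ℤ) (x : EuclideanSpace ℝ (Fin n)) : Prop :=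
  (∀ j, d j ∈ D) ∧ HasSum (fun j : ℕ => (invMap A ^ (j + 1)) (realVec (d j))) x

/-- The set `T_{A, D}` of all points with an `(A, D)`-representation. -/
def T {n : ℕ} (A : Matrix (Fin n) (Fin n) ℤ) (D : Finset (Fin n → ℤ)) :
    Set (EuclideanSpace ℝ (Fin n)) :=
  {x | ∃ d : ℕ → Fin n → ℤ, IsRepresentation A D d x}

/-- The sequence of sets `E` consists of `U₁, …, U_p` followed by the block
`U₁ + V₁, …, U_p + V_p` repeated forever (indices are shifted to start from `0`). -/
def IsSEPWith {M : Type*} [Add M] [DecidableEq M] (E : ℕ → Finset M) (p : ℕ) [NeZero p]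
    (U V : Fin p → Finset M) : Prop :=
  (∀ l : Fin p, E l = U l) ∧ ∀ j : ℕ, p ≤ j → E j = U (Fin.ofNat p j) + V (Fin.ofNat p j)


/-- The set `T_{A, D}` is the attractor of the iterated function system
`x ↦ A⁻¹ (x + d)`, `d ∈ D`. -/
theorem eq_T_of_isAttractor {n : ℕ} (A : Matrix (Fin n) (Fin n) ℤ)
    (hsim : IsSimilarity (invMap A)) (D : Finset (Fin n → ℤ))
    (K : Set (EuclideanSpace ℝ (Fin n))) (hK : IsCompact K) (hne : K.Nonempty)
    (hinv : K = ⋃ d ∈ D, (fun x => invMap A (x + realVec d)) '' K) :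
    K = T A D := by
  obtain ⟨c, hc0, hc1, hc⟩ := hsim
  have hL : ∀ x, ‖invMap A x‖ = c * ‖x‖ := fun x => by
    have := hc x 0
    simpa using this
  have hLk : ∀ (k : ℕ) x, ‖(invMap A ^ k) x‖ = c ^ k * ‖x‖ := by
    intro k
    induction k with
    | zero => intro x; simp
    | succ k ih => intro x; rw [pow_succ, Module.End.mul_apply, ih, hL]; ring
  have hlim0 : ∀ z : ℕ → EuclideanSpace ℝ (Fin n), (∀ k, z k ∈ K) →
      Filter.Tendsto (fun k => (invMap A ^ k) (z k)) Filter.atTop (nhds 0) := by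
    intro z hz
    obtain ⟨M, hM⟩ := hK.isBounded.exists_norm_le
    have h0 : Filter.Tendsto (fun k : ℕ => c ^ k * M) Filter.atTop (nhds 0) := by
      simpa using (tendsto_pow_atTop_nhds_zero_of_lt_one hc0.le hc1).mul_const M
    refine squeeze_zero_norm (fun k => ?_) h0
    rw [hLk]
    exact mul_le_mul_of_nonneg_left (hM _ (hz k)) (by positivity)
  have hsum : ∀ d : ℕ → Fin n → ℤ, (∀ j, d j ∈ D) →
      Summable (fun j : ℕ => (invMap A ^ (j + 1)) (realVec (d j))) := by
    intro d hd
    refine Summable.of_norm_bounded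
      (g := fun j : ℕ => c ^ j * (c * ∑ e ∈ D, ‖realVec e‖))
      ((summable_geometric_of_lt_one hc0.le hc1).mul_right _) (fun j => ?_)
    rw [hLk, pow_succ, mul_assoc]
    have : ‖realVec (d j)‖ ≤ ∑ e ∈ D, ‖realVec e‖ :=
      Finset.single_le_sum (f := fun e => ‖realVec e‖) (fun _ _ => norm_nonneg _) (hd j)
    gcongr
  apply Set.Subset.antisymm
  · intro x hx
    have hstep : ∀ y : K, ∃ (d : Fin n → ℤ) (z : K), d ∈ D ∧
        invMap A ((z : EuclideanSpace ℝ (Fin n)) + realVec d) = y := by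
      rintro ⟨y, hy⟩
      rw [hinv] at hy
      simp only [Set.mem_iUnion, Set.mem_image] at hy
      obtain ⟨d, hd, z, hz, h⟩ := hy
      exact ⟨d, ⟨z, hz⟩, hd, h⟩
    choose d z hd hz using hstep
    let s : ℕ → K := fun k => z^[k] ⟨x, hx⟩
    have hs : ∀ k, z (s k) = s (k + 1) := fun k =>
      (Function.iterate_succ_apply' z k _).symm
    have hpart : ∀ k, x = ∑ j ∈ Finset.range k, (invMap A ^ (j + 1)) (realVec (d (s j)))
        + (invMap A ^ k) (s k : EuclideanSpace ℝ (Fin n)) := by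
      intro k
      induction k with
      | zero => simp [s]
      | succ k ih =>
        rw [ih, Finset.sum_range_succ, ← hz (s k), hs k, map_add, map_add, pow_succ,
          Module.End.mul_apply, Module.End.mul_apply]
        abel
    refine ⟨fun j => d (s j), fun j => hd _, ?_⟩
    rw [(hsum _ fun j => hd _).hasSum_iff_tendsto_nat]
    have h1 := (hlim0 (fun k => (s k : EuclideanSpace ℝ (Fin n))) fun k => (s k).2).const_sub x
    rw [sub_zero] at h1
    refine h1.congr fun k => ?_
    rw [sub_eq_iff_eq_add]
    exact hpart k
  · rintro x ⟨d, hd, hx⟩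
    obtain ⟨z0, hz0⟩ := hne
    have hmem : ∀ k, ∀ z ∈ K, ∑ j ∈ Finset.range k, (invMap A ^ (j + 1)) (realVec (d j))
        + (invMap A ^ k) z ∈ K := by
      intro k
      induction k with
      | zero => intro z hz; simpa using hz
      | succ k ih =>
        intro z hz
        have h1 : invMap A (z + realVec (d k)) ∈ K := by
          rw [hinv]
          simp only [Set.mem_iUnion]
          exact ⟨d k, hd k, z, hz, rfl⟩
        have h2 := ih _ h1
        rw [Finset.sum_range_succ]
        convert h2 using 1
        rw [map_add, map_add, pow_succ, Module.End.mul_apply, Module.End.mul_apply]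
        abel
    have h1 := hx.tendsto_sum_nat.add (hlim0 (fun _ => z0) fun _ => hz0)
    rw [add_zero] at h1
    exact hK.isClosed.mem_of_tendsto h1 (Filter.Eventually.of_forall fun k => hmem k z0 hz0)

end SelfAffine

open MeasureTheory Filter Topology
open scoped ENNReal NNReal

namespace SelfAffine

variable {n : ℕ} {A : Matrix (Fin n) (Fin n) ℤ} {c : ℝ}

/-! If `x = ∑ A⁻ʲ dⱼ` and `x - α = ∑ A⁻ʲ eⱼ`, then `d - e` represents `α`, so uniqueness forces `dⱼ
- eⱼ = αⱼ`. The intersection is thus the set of sums with `dⱼ ∈ Eⱼ = D ∩ (D + αⱼ)`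
(`T_inter_image_add_eq_digitSet`), and its dimension depends only on the cardinalities `|Eⱼ|`,
periodic from index `p` on.

Let `N_k` be the product of the first `k` cardinalities. A `k`-digit prefix sums to `A⁻ᵏ z` with `z`
an integer vector, and the tail is `O(cᵏ)`. Hence `N_k` balls of radius `O(cᵏ)` cover the set
(`dimH_digitSet_le`). Conversely, digits incongruent mod `A` make `z` determine the prefix, and a
set of diameter at most `cᵏ` meets boundedly many values of `z`; the uniform product measure gives
it mass `O(1 / N_k)`, so the mass distribution principle applies (`le_dimH_digitSet`).

Both bounds hold at the exponent `s` for which `N_k c^(ks)` stays between positive constants, i.e.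
`N c^(ps) = 1` with `N` the product over one period. Comparing volumes gives `c = |det A|^(-1/n)`.
-/

theorem realVec_add (x y : Fin n → ℤ) : realVec (x + y) = realVec x + realVec y := by
  ext i; simp [realVec]

theorem realVec_sub (x y : Fin n → ℤ) : realVec (x - y) = realVec x - realVec y := by
  ext i; simp [realVec]

theorem finite_setOf_norm_realVec_le (R : ℝ) : {z : Fin n → ℤ | ‖realVec z‖ ≤ R}.Finite := by
  refine (Set.finite_Icc (fun _ : Fin n => -⌈R⌉) (fun _ => ⌈R⌉)).subset fun z hz => ?_
  have h : ∀ i, |z i| ≤ ⌈R⌉ := fun i => by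
    have h1 : ‖realVec z i‖ ≤ ‖realVec z‖ := PiLp.norm_apply_le (realVec z) i
    have h2 : |(z i : ℝ)| ≤ ⌈R⌉ := (h1.trans hz).trans (Int.le_ceil R)
    exact_mod_cast h2
  exact ⟨fun i => (abs_le.1 (h i)).1, fun i => (abs_le.1 (h i)).2⟩

theorem invMap_realVec_mulVec (hA : IsUnit (realMat A)) (z : Fin n → ℤ) :
    invMap A (realVec (A.mulVec z)) = realVec z := by
  have h : realVec (A.mulVec z) = WithLp.toLp 2 ((realMat A).mulVec (fun i => (z i : ℝ))) := by
    ext i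
    simp [realVec, realMat, Matrix.mulVec, dotProduct]
  rw [h, invMap, Matrix.toLpLin_toLp, Matrix.toLin'_apply, Matrix.mulVec_mulVec,
    Matrix.nonsing_inv_mul _ ((Matrix.isUnit_iff_isUnit_det _).1 hA), Matrix.one_mulVec]
  rfl

theorem mulVec_injective (hA : IsUnit (realMat A)) : Function.Injective A.mulVec := by
  intro x y h
  have h' := congrArg (fun v => invMap A (realVec v)) h
  simp only [invMap_realVec_mulVec hA] at h'
  ext i
  have := congrArg (fun v : EuclideanSpace ℝ (Fin n) => v i) h'
  simpa [realVec] using this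

theorem norm_pow_apply {V : Type*} [SeminormedAddCommGroup V] [Module ℝ V] {L : V →ₗ[ℝ] V}
    (hL : ∀ x, ‖L x‖ = c * ‖x‖) (k : ℕ) (x : V) : ‖(L ^ k) x‖ = c ^ k * ‖x‖ := by
  induction k generalizing x with
  | zero => simp
  | succ k ih => rw [pow_succ, Module.End.mul_apply, ih, hL]; ring

/-! ### Integer prefixes and digit expansions -/

/-- The integer vector `∑_{j < k} A ^ (k - 1 - j) d j`. -/
def intPart (A : Matrix (Fin n) (Fin n) ℤ) (d : ℕ → Fin n → ℤ) : ℕ → Fin n → ℤ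
  | 0 => 0
  | k + 1 => A.mulVec (intPart A d k) + d k

theorem sum_range_eq_pow_intPart (hA : IsUnit (realMat A)) (d : ℕ → Fin n → ℤ) (k : ℕ) :
    ∑ j ∈ Finset.range k, (invMap A ^ (j + 1)) (realVec (d j)) =
      (invMap A ^ k) (realVec (intPart A d k)) := by
  induction k with
  | zero =>
    simp only [Finset.range_zero, Finset.sum_empty, pow_zero, Module.End.one_apply, intPart]
    ext i; simp [realVec]
  | succ k ih =>
    rw [Finset.sum_range_succ, ih, intPart, realVec_add, map_add, pow_succ, Module.End.mul_apply,
      Module.End.mul_apply, invMap_realVec_mulVec hA]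

theorem IsCompleteResidueSystem.eq_of_sub_eq_mulVec {R : Set (Fin n → ℤ)}
    (hR : IsCompleteResidueSystem A R) {d e v : Fin n → ℤ} (hd : d ∈ R) (he : e ∈ R)
    (h : d - e = A.mulVec v) : d = e := by
  have h1 : (⟨d, hd⟩ : R) = ⟨e, he⟩ :=
    hR.1 ((Submodule.Quotient.eq _).2 ⟨v, h.symm⟩)
  exact congrArg Subtype.val h1

/-- Reduction mod `A` recovers the last digit; cancelling it and using injectivity of `A` leaves the
shorter prefix. -/
theorem eq_of_intPart_eq (hA : IsUnit (realMat A)) {R : Set (Fin n → ℤ)}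
    (hR : IsCompleteResidueSystem A R) {d e : ℕ → Fin n → ℤ} (hd : ∀ j, d j ∈ R)
    (he : ∀ j, e j ∈ R) {k : ℕ} (h : intPart A d k = intPart A e k) : ∀ j < k, d j = e j := by
  induction k with
  | zero => simp
  | succ k ih =>
    simp only [intPart] at h
    have h1 : d k = e k := by
      refine hR.eq_of_sub_eq_mulVec (hd k) (he k) (v := intPart A e k - intPart A d k) ?_
      rw [Matrix.mulVec_sub, sub_eq_sub_iff_add_eq_add, add_comm, h, add_comm]
    rw [h1, add_left_inj] at h
    intro j hj
    rcases Nat.lt_succ_iff_lt_or_eq.1 hj with hj | rfl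
    · exact ih (mulVec_injective hA h) j hj
    · exact h1

/-- The set of all sums `∑_{j ≥ 0} A ^ (-(j + 1)) d j` with `d j ∈ E j`. -/
def digitSet (A : Matrix (Fin n) (Fin n) ℤ) (E : ℕ → Finset (Fin n → ℤ)) :
    Set (EuclideanSpace ℝ (Fin n)) :=
  {x | ∃ d : ℕ → Fin n → ℤ, (∀ j, d j ∈ E j) ∧
    HasSum (fun j : ℕ => (invMap A ^ (j + 1)) (realVec (d j))) x}

theorem norm_term_le (hc0 : 0 < c) (hL : ∀ x, ‖invMap A x‖ = c * ‖x‖) (D : Finset (Fin n → ℤ))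
    {d : ℕ → Fin n → ℤ} (hd : ∀ j, d j ∈ D) (j : ℕ) :
    ‖(invMap A ^ (j + 1)) (realVec (d j))‖ ≤ c ^ j * (c * ∑ e ∈ D, ‖realVec e‖) := by
  rw [norm_pow_apply hL, pow_succ, mul_assoc]
  have : ‖realVec (d j)‖ ≤ ∑ e ∈ D, ‖realVec e‖ :=
    Finset.single_le_sum (f := fun e => ‖realVec e‖) (fun _ _ => norm_nonneg _) (hd j)
  gcongr

theorem summable_term (hc0 : 0 < c) (hc1 : c < 1) (hL : ∀ x, ‖invMap A x‖ = c * ‖x‖)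
    (D : Finset (Fin n → ℤ)) {d : ℕ → Fin n → ℤ} (hd : ∀ j, d j ∈ D) :
    Summable (fun j : ℕ => (invMap A ^ (j + 1)) (realVec (d j))) :=
  Summable.of_norm_bounded ((summable_geometric_of_lt_one hc0.le hc1).mul_right _)
    (norm_term_le hc0 hL D hd)

/-- Geometric tail bound. One `B` serves all digit sequences and all levels, as both dimension
bounds require. -/
theorem exists_norm_sub_pow_intPart_le (hA : IsUnit (realMat A)) (hc0 : 0 < c) (hc1 : c < 1)
    (hL : ∀ x, ‖invMap A x‖ = c * ‖x‖) (D : Finset (Fin n → ℤ)) :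
    ∃ B : ℝ, 0 ≤ B ∧ ∀ (d : ℕ → Fin n → ℤ) (x : EuclideanSpace ℝ (Fin n)), (∀ j, d j ∈ D) →
      HasSum (fun j : ℕ => (invMap A ^ (j + 1)) (realVec (d j))) x →
      ∀ k, ‖x - (invMap A ^ k) (realVec (intPart A d k))‖ ≤ c ^ k * B := by
  have h1c : 0 < 1 - c := sub_pos.2 hc1
  refine ⟨(1 - c)⁻¹ * (c * ∑ e ∈ D, ‖realVec e‖), ?_, fun d x hd hx k => ?_⟩
  · have : 0 ≤ ∑ e ∈ D, ‖realVec e‖ := Finset.sum_nonneg fun _ _ => norm_nonneg _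
    positivity
  · have h1 := (hasSum_nat_add_iff' k).2 hx
    rw [sum_range_eq_pow_intPart hA] at h1
    have h2 := (((hasSum_geometric_of_lt_one hc0.le hc1).mul_right
      (c * ∑ e ∈ D, ‖realVec e‖)).mul_left (c ^ k))
    refine h1.norm_le_of_bounded h2 fun j => ?_
    refine (norm_term_le hc0 hL D hd (j + k)).trans_eq ?_
    ring

theorem T_inter_image_add_eq_digitSet (D : Finset (Fin n → ℤ))
    (α : EuclideanSpace ℝ (Fin n)) (a : ℕ → Fin n → ℤ) (ha : IsRepresentation A (D - D) a α)
    (huniq : ∀ a' : ℕ → Fin n → ℤ, IsRepresentation A (D - D) a' α → a' = a) :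
    T A D ∩ ((fun x => x + α) '' T A D) = digitSet A (fun j => D ∩ (D + {a j})) := by
  ext x
  constructor
  · rintro ⟨⟨d, hd, hx⟩, y, ⟨e, he, hy⟩, rfl⟩
    have h : (fun j => d j - e j) = a := by
      refine huniq _ ⟨fun j => Finset.sub_mem_sub (hd j) (he j), ?_⟩
      have := hx.sub hy
      simpa [realVec_sub] using this
    refine ⟨d, fun j => ?_, hx⟩
    rw [Finset.mem_inter, ← h]
    exact ⟨hd j, Finset.mem_add.2 ⟨e j, he j, _, Finset.mem_singleton_self _, by simp⟩⟩
  · rintro ⟨d, hd, hx⟩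
    have h : ∀ j, d j - a j ∈ D := fun j => by
      obtain ⟨e, he, b, hb, h⟩ := Finset.mem_add.1 (Finset.mem_inter.1 (hd j)).2
      rw [Finset.mem_singleton] at hb
      rwa [← h, hb, add_sub_cancel_right]
    refine ⟨⟨d, fun j => (Finset.mem_inter.1 (hd j)).1, hx⟩, x - α,
      ⟨fun j => d j - a j, h, ?_⟩, sub_add_cancel x α⟩
    have := hx.sub ha.2
    simpa [realVec_sub] using this

/-! ### Upper bound: covering by balls -/

theorem exists_finset_intPart (A : Matrix (Fin n) (Fin n) ℤ) (E : ℕ → Finset (Fin n → ℤ)) (k : ℕ) :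
    ∃ W : Finset (Fin n → ℤ), W.card ≤ ∏ j ∈ Finset.range k, (E j).card ∧
      ∀ d : ℕ → Fin n → ℤ, (∀ j, d j ∈ E j) → intPart A d k ∈ W := by
  induction k with
  | zero => exact ⟨{0}, by simp, fun d _ => by simp [intPart]⟩
  | succ k ih =>
    obtain ⟨W, hW, hmem⟩ := ih
    refine ⟨Finset.image₂ (fun z e => A.mulVec z + e) W (E k), ?_, fun d hd =>
      Finset.mem_image₂_of_mem (hmem d hd) (hd k)⟩
    rw [Finset.prod_range_succ]
    exact (Finset.card_image₂_le _ _ _).trans (Nat.mul_le_mul_right _ hW)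

/-- The level-`k` balls have `s`-sums at most `C (2B)^s` and diameters tending to `0`, so the
`s`-dimensional Hausdorff measure is finite. -/
theorem dimH_digitSet_le (hA : IsUnit (realMat A)) (hc0 : 0 < c) (hc1 : c < 1)
    (hL : ∀ x, ‖invMap A x‖ = c * ‖x‖) {D : Finset (Fin n → ℤ)} {E : ℕ → Finset (Fin n → ℤ)}
    (hED : ∀ j, E j ⊆ D) {s : ℝ≥0} {C : ℝ}
    (hC : ∀ k, (∏ j ∈ Finset.range k, ((E j).card : ℝ)) * (c ^ k) ^ (s : ℝ) ≤ C) :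
    dimH (digitSet A E) ≤ s := by
  obtain ⟨B, hB0, hB⟩ := exists_norm_sub_pow_intPart_le hA hc0 hc1 hL D
  choose W hWcard hW using exists_finset_intPart A E
  let t : ∀ k, W k → Set (EuclideanSpace ℝ (Fin n)) := fun k w =>
    Metric.closedBall ((invMap A ^ k) (realVec (w : Fin n → ℤ))) (c ^ k * B)
  have hdiam : ∀ k w, Metric.ediam (t k w) ≤ ENNReal.ofReal (c ^ k * (2 * B)) := fun k w =>
    Metric.ediam_le_of_forall_dist_le fun x hx y hy => by
      have h1 := dist_triangle_right x y ((invMap A ^ k) (realVec (w : Fin n → ℤ)))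
      have h2 := Metric.mem_closedBall.1 hx
      have h3 := Metric.mem_closedBall.1 hy
      linarith
  have hr : Tendsto (fun k : ℕ => ENNReal.ofReal (c ^ k * (2 * B))) atTop (𝓝 0) := by
    have := (tendsto_pow_atTop_nhds_zero_of_lt_one hc0.le hc1).mul_const (2 * B)
    simpa using ENNReal.tendsto_ofReal this
  have hcov : ∀ k, digitSet A E ⊆ ⋃ w, t k w := by
    rintro k x ⟨d, hd, hx⟩
    refine Set.mem_iUnion.2 ⟨⟨intPart A d k, hW k d hd⟩, ?_⟩
    rw [Metric.mem_closedBall, dist_eq_norm]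
    exact hB d x (fun j => hED j (hd j)) hx k
  have hsum : ∀ k, ∑ w, Metric.ediam (t k w) ^ (s : ℝ) ≤
      ENNReal.ofReal (C * (2 * B) ^ (s : ℝ)) := by
    intro k
    have hck : 0 ≤ c ^ k := by positivity
    calc ∑ w, Metric.ediam (t k w) ^ (s : ℝ)
        ≤ ∑ _w : W k, ENNReal.ofReal ((c ^ k * (2 * B)) ^ (s : ℝ)) := by
          refine Finset.sum_le_sum fun w _ => ?_
          rw [← ENNReal.ofReal_rpow_of_nonneg (by positivity) s.coe_nonneg]
          exact ENNReal.rpow_le_rpow (hdiam k w) s.coe_nonneg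
      _ = ENNReal.ofReal ((W k).card * ((c ^ k * (2 * B)) ^ (s : ℝ))) := by
          rw [ENNReal.ofReal_mul (by positivity)]
          simp
      _ ≤ _ := by
          refine ENNReal.ofReal_le_ofReal ?_
          rw [Real.mul_rpow hck (by positivity), ← mul_assoc]
          refine mul_le_mul_of_nonneg_right (le_trans ?_ (hC k)) (by positivity)
          refine mul_le_mul_of_nonneg_right ?_ (by positivity)
          exact_mod_cast hWcard k
  refine dimH_le_of_hausdorffMeasure_ne_top (ne_top_of_le_ne_top
    (ENNReal.ofReal_ne_top (r := C * (2 * B) ^ (s : ℝ))) ?_)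
  refine (Measure.hausdorffMeasure_le_liminf_sum (s : ℝ) (digitSet A E) (l := atTop) _ hr t
    (Eventually.of_forall fun k w => hdiam k w) (Eventually.of_forall hcov)).trans ?_
  exact (liminf_le_liminf (Eventually.of_forall hsum)).trans_eq (liminf_const _)

/-! ### Lower bound: mass distribution -/

/-- For the product of uniform measures, the event lies in a single cylinder because the integer
prefix determines its digits. -/
theorem exists_measure_digits (hA : IsUnit (realMat A)) {R : Set (Fin n → ℤ)}
    (hR : IsCompleteResidueSystem A R) {E : ℕ → Finset (Fin n → ℤ)}
    (hER : ∀ j, (E j : Set (Fin n → ℤ)) ⊆ R) (hne : ∀ j, (E j).Nonempty) :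
    ∃ μ : Measure (∀ j, E j), IsProbabilityMeasure μ ∧ ∀ (k : ℕ) (z : Fin n → ℤ),
      μ {ω | intPart A (fun j => ω j) k = z} ≤ (∏ j ∈ Finset.range k, ((E j).card : ℝ≥0∞))⁻¹ := by
  have hne' : ∀ j, Nonempty (E j) := fun j => (hne j).to_subtype
  let ν : ∀ j, Measure (E j) := fun j => (PMF.uniformOfFintype (E j)).toMeasure
  have hν : ∀ j, IsProbabilityMeasure (ν j) := fun j => inferInstance
  refine ⟨Measure.infinitePi ν, inferInstance, fun k z => ?_⟩
  rcases Set.eq_empty_or_nonempty {ω : ∀ j, E j | intPart A (fun j => ω j) k = z} with h | ⟨ω₀, h₀⟩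
  · simp [h]
  · have hsub : {ω : ∀ j, E j | intPart A (fun j => ω j) k = z} ⊆
        (Finset.range k : Set ℕ).pi (fun j => {ω₀ j}) := by
      intro ω hω j hj
      have := eq_of_intPart_eq hA hR (fun j => hER j (ω j).2) (fun j => hER j (ω₀ j).2)
        (Eq.trans hω h₀.symm) j (by simpa using hj)
      exact Subtype.ext this
    refine (measure_mono hsub).trans_eq ?_
    rw [Measure.infinitePi_pi _ fun j _ => measurableSet_singleton _]
    rw [ENNReal.prod_inv_distrib]
    · refine Finset.prod_congr rfl fun j _ => ?_
      rw [PMF.toMeasure_apply_singleton _ _ (measurableSet_singleton _)]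
      simp
    · intro i _ j _ _
      simp [(hne i).ne_empty]

theorem measurable_of_hasSum_digits {E : ℕ → Finset (Fin n → ℤ)}
    {π : (∀ j, E j) → EuclideanSpace ℝ (Fin n)}
    (hπ : ∀ ω : ∀ j, E j,
      HasSum (fun j : ℕ => (invMap A ^ (j + 1)) (realVec (ω j : Fin n → ℤ))) (π ω)) :
    Measurable π := by
  refine measurable_of_tendsto_metrizable (f := fun (k : ℕ) (ω : ∀ j, E j) =>
    ∑ j ∈ Finset.range k, (invMap A ^ (j + 1)) (realVec (ω j : Fin n → ℤ))) (fun k => ?_)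
    (tendsto_pi_nhds.2 fun ω => (hπ ω).tendsto_sum_nat)
  refine Finset.measurable_sum _ fun j _ => ?_
  exact (measurable_of_countable fun e : E j =>
    (invMap A ^ (j + 1)) (realVec (e : Fin n → ℤ))).comp (measurable_pi_apply j)

/-- Mass distribution principle for sets whose diameter is compared with the powers of `c`. -/
theorem exists_pos_smul_le_hausdorffMeasure {X : Type*} [MetricSpace X] [MeasurableSpace X]
    [BorelSpace X] (hc0 : 0 < c) (hc1 : c < 1) (ν : Measure X) {s : ℝ} (hs : 0 < s) {C : ℝ}
    (hC : 0 < C) (h : ∀ (t : Set X) (k : ℕ), Metric.ediam t ≤ ENNReal.ofReal (c ^ k) →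
      ν t ≤ ENNReal.ofReal (C * (c ^ k) ^ s)) :
    ∃ r : ℝ≥0∞, r ≠ 0 ∧ r • ν ≤ μH[s] := by
  have hcs : 0 < c ^ s := Real.rpow_pos_of_pos hc0 s
  have hK : 0 < C * (c ^ s)⁻¹ := by positivity
  have hKtop : ENNReal.ofReal (C * (c ^ s)⁻¹) ≠ ∞ := ENNReal.ofReal_ne_top
  refine ⟨(ENNReal.ofReal (C * (c ^ s)⁻¹))⁻¹, ENNReal.inv_ne_zero.2 hKtop, ?_⟩
  refine Measure.le_hausdorffMeasure s _ 1 one_pos fun t ht => ?_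
  rw [Measure.smul_apply, smul_eq_mul, ENNReal.inv_mul_le_iff
    (by simpa using hK) hKtop]
  rcases eq_or_ne (Metric.ediam t) 0 with h0 | h0
  -- A set of diameter `0` satisfies the bound for every `k`, so it is null; this uses `s > 0`.
  · have hlim : Tendsto (fun k : ℕ => ENNReal.ofReal (C * (c ^ k) ^ s)) atTop (𝓝 0) := by
      have h1 := (Real.continuousAt_rpow_const 0 s (Or.inr hs.le)).tendsto.comp
        (tendsto_pow_atTop_nhds_zero_of_lt_one hc0.le hc1)
      have h2 := ENNReal.tendsto_ofReal (h1.const_mul C)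
      simpa [Real.zero_rpow hs.ne'] using h2
    have : ν t ≤ 0 := ge_of_tendsto' hlim fun k => h t k (by simp [h0])
    exact this.trans zero_le
  · have htop : Metric.ediam t ≠ ∞ := ne_top_of_le_ne_top ENNReal.one_ne_top ht
    set δ := (Metric.ediam t).toReal with hδ
    have hδt : Metric.ediam t = ENNReal.ofReal δ := (ENNReal.ofReal_toReal htop).symm
    have hδ0 : 0 < δ := ENNReal.toReal_pos h0 htop
    have hδ1 : δ ≤ 1 := by
      simpa using ENNReal.toReal_mono ENNReal.one_ne_top ht
    -- Here `c ^ (k + 1) < δ ≤ c ^ k`; rounding `δ` up to `c ^ k` costs the factor `(c ^ s)⁻¹`.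
    obtain ⟨k, hk1, hk2⟩ := exists_nat_pow_near_of_lt_one hδ0 hδ1 hc0 hc1
    refine (h t k (hδt ▸ ENNReal.ofReal_le_ofReal hk2)).trans ?_
    rw [hδt, ENNReal.ofReal_rpow_of_pos hδ0, ← ENNReal.ofReal_mul hK.le]
    refine ENNReal.ofReal_le_ofReal ?_
    have h3 : (c ^ k) ^ s * c ^ s ≤ δ ^ s := by
      rw [← Real.mul_rpow (by positivity) hc0.le, ← pow_succ]
      exact Real.rpow_le_rpow (by positivity) hk1.le hs.le
    rw [mul_assoc]
    refine mul_le_mul_of_nonneg_left ?_ hC.le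
    rwa [inv_mul_eq_div, le_div_iff₀ hcs]

theorem le_dimH_digitSet (hA : IsUnit (realMat A)) (hc0 : 0 < c) (hc1 : c < 1)
    (hL : ∀ x, ‖invMap A x‖ = c * ‖x‖) {R : Set (Fin n → ℤ)}
    (hR : IsCompleteResidueSystem A R) {D : Finset (Fin n → ℤ)}
    (hDR : (D : Set (Fin n → ℤ)) ⊆ R) {E : ℕ → Finset (Fin n → ℤ)}
    (hED : ∀ j, E j ⊆ D) (hne : ∀ j, (E j).Nonempty) {s : ℝ≥0} {C : ℝ} (hC0 : 0 < C)
    (hC : ∀ k, C ≤ (∏ j ∈ Finset.range k, ((E j).card : ℝ)) * (c ^ k) ^ (s : ℝ)) :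
    s ≤ dimH (digitSet A E) := by
  rcases eq_or_ne s 0 with rfl | hs
  · simp
  have hs0 : (0 : ℝ) < s := by positivity
  obtain ⟨B, hB0, hB⟩ := exists_norm_sub_pow_intPart_le hA hc0 hc1 hL D
  obtain ⟨μ, hμ, hμk⟩ := exists_measure_digits hA hR
    (fun j => (Finset.coe_subset.2 (hED j)).trans hDR) hne
  have hsum : ∀ ω : ∀ j, E j, Summable (fun j : ℕ => (invMap A ^ (j + 1))
      (realVec (ω j : Fin n → ℤ))) := fun ω =>
    summable_term hc0 hc1 hL D fun j => hED j (ω j).2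
  choose π hπ using hsum
  have hπm := measurable_of_hasSum_digits hπ
  -- After scaling by `c ^ k`, two prefixes seen by one set differ by at most `1` (its diameter)
  -- plus `B` for each of the two tails.
  have hfin := finite_setOf_norm_realVec_le (n := n) (1 + 2 * B)
  set F := hfin.toFinset with hF
  have hmass : ∀ (t : Set (EuclideanSpace ℝ (Fin n))) (k : ℕ),
      Metric.ediam t ≤ ENNReal.ofReal (c ^ k) →
      -- The `+ 1` makes positivity of the constant immediate.
      μ.map π t ≤ ENNReal.ofReal ((F.card + 1) / C * (c ^ k) ^ (s : ℝ)) := by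
    intro t k ht
    have hck : 0 < c ^ k := by positivity
    have hN : 0 < ∏ j ∈ Finset.range k, ((E j).card : ℝ) :=
      Finset.prod_pos fun j _ => by exact_mod_cast (hne j).card_pos
    -- The closure has the same diameter and is measurable, so the pushforward can be evaluated on
    -- it.
    refine (measure_mono subset_closure).trans ?_
    rw [← Metric.ediam_closure] at ht
    rw [Measure.map_apply hπm isClosed_closure.measurableSet]
    rcases Set.eq_empty_or_nonempty (π ⁻¹' closure t) with h | ⟨ω₀, h₀⟩
    · simp [h]
    let Z : (∀ j, E j) → Fin n → ℤ := fun ω => intPart A (fun j => ω j) k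
    have hsub : π ⁻¹' closure t ⊆ ⋃ z ∈ F, {ω | Z ω = z + Z ω₀} := by
      intro ω hω
      simp only [Set.mem_iUnion, Set.mem_ofPred_eq]
      refine ⟨Z ω - Z ω₀, ?_, (sub_add_cancel _ _).symm⟩
      rw [hF, Set.Finite.mem_toFinset, Set.mem_ofPred_eq, realVec_sub]
      have h1 : ‖π ω - π ω₀‖ ≤ c ^ k := by
        rw [← dist_eq_norm]
        have := (Metric.edist_le_ediam_of_mem (show π ω ∈ closure t from hω) h₀).trans ht
        rwa [edist_dist, ENNReal.ofReal_le_ofReal_iff hck.le] at this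
      have h2 := hB (fun j => ω j) (π ω) (fun j => hED j (ω j).2) (hπ ω) k
      have h3 := hB (fun j => ω₀ j) (π ω₀) (fun j => hED j (ω₀ j).2) (hπ ω₀) k
      have h4 : c ^ k * ‖realVec (Z ω) - realVec (Z ω₀)‖ ≤ c ^ k * (1 + 2 * B) := by
        rw [← norm_pow_apply hL, map_sub]
        have h5 : (invMap A ^ k) (realVec (Z ω)) - (invMap A ^ k) (realVec (Z ω₀)) =
            (π ω - π ω₀) - (π ω - (invMap A ^ k) (realVec (Z ω))) +
              (π ω₀ - (invMap A ^ k) (realVec (Z ω₀))) := by abel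
        rw [h5]
        refine (norm_add_le _ _).trans ?_
        have h6 := norm_sub_le (π ω - π ω₀) (π ω - (invMap A ^ k) (realVec (Z ω)))
        linarith
      exact le_of_mul_le_mul_left h4 hck
    calc μ (π ⁻¹' closure t) ≤ ∑ z ∈ F, μ {ω | Z ω = z + Z ω₀} :=
          (measure_mono hsub).trans (measure_biUnion_finset_le _ _)
      _ ≤ ∑ _z ∈ F, (∏ j ∈ Finset.range k, ((E j).card : ℝ≥0∞))⁻¹ :=
          Finset.sum_le_sum fun z _ => hμk k _
      _ = ENNReal.ofReal (F.card * (∏ j ∈ Finset.range k, ((E j).card : ℝ))⁻¹) := by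
          rw [ENNReal.ofReal_mul (by positivity), ENNReal.ofReal_inv_of_pos hN,
            ENNReal.ofReal_prod_of_nonneg (fun _ _ => by positivity)]
          simp
      _ ≤ _ := by
          refine ENNReal.ofReal_le_ofReal ?_
          rw [← div_eq_mul_inv, div_mul_eq_mul_div, div_le_div_iff₀ hN hC0]
          have hp : 0 ≤ (c ^ k) ^ (s : ℝ) := by positivity
          nlinarith [hC k, mul_le_mul_of_nonneg_left (hC k) (Nat.cast_nonneg (α := ℝ) F.card),
            mul_nonneg hN.le hp]
  obtain ⟨r, hr, hle⟩ := exists_pos_smul_le_hausdorffMeasure hc0 hc1 (μ.map π) hs0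
    (by positivity) hmass
  refine le_dimH_of_hausdorffMeasure_ne_zero fun h => ?_
  have h1 := hle (digitSet A E)
  rw [h, Measure.smul_apply, smul_eq_mul, nonpos_iff_eq_zero, mul_eq_zero] at h1
  -- This inequality holds without measurability of the digit set.
  have h2 := Measure.le_map_apply (μ := μ) hπm.aemeasurable (digitSet A E)
  have h3 : π ⁻¹' digitSet A E = Set.univ :=
    Set.eq_univ_of_forall fun ω => ⟨fun j => ω j, fun j => (ω j).2, hπ ω⟩
  rw [h3, measure_univ, h1.resolve_left hr] at h2
  simp at h2

/-! ### Contraction ratio and determinant -/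

/-- The determinant of a similarity of ratio `c` has absolute value `c ^ n`. -/
theorem abs_det_of_norm_eq (hc0 : 0 < c) {L : EuclideanSpace ℝ (Fin n) →ₗ[ℝ] EuclideanSpace ℝ (Fin n)}
    (hL : ∀ x, ‖L x‖ = c * ‖x‖) : |LinearMap.det L| = c ^ n := by
  have h1 := Measure.addHaar_image_linearMap (volume : Measure (EuclideanSpace ℝ (Fin n))) L
    (Metric.closedBall 0 1)
  have hinj : Function.Injective L := by
    rw [injective_iff_map_eq_zero]
    intro x hx
    have := hL x
    rw [hx, norm_zero, zero_eq_mul] at this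
    simpa using this.resolve_left hc0.ne'
  have hsurj : Function.Surjective L := LinearMap.injective_iff_surjective.1 hinj
  -- The unit ball maps onto the ball of radius `c`, so its volume scales both by `|det L|` and by
  -- `c ^ n`.
  have h2 : L '' Metric.closedBall 0 1 = Metric.closedBall 0 c := by
    ext y
    simp only [Set.mem_image, mem_closedBall_zero_iff]
    constructor
    · rintro ⟨x, hx, rfl⟩
      rw [hL]
      nlinarith
    · intro hy
      obtain ⟨x, rfl⟩ := hsurj y
      rw [hL] at hy
      exact ⟨x, by nlinarith, rfl⟩
  rw [h2, Measure.addHaar_closedBall _ _ hc0.le] at h1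
  have h3 : volume (Metric.closedBall (0 : EuclideanSpace ℝ (Fin n)) 1) ≠ ∞ :=
    measure_closedBall_lt_top.ne
  have h4 : volume (Metric.ball (0 : EuclideanSpace ℝ (Fin n)) 1) ≠ 0 :=
    (Metric.measure_ball_pos _ _ one_pos).ne'
  rw [← Measure.addHaar_unitClosedBall_eq_addHaar_unitBall] at h1 h4
  rw [ENNReal.mul_left_inj h4 h3, finrank_euclideanSpace_fin] at h1
  exact ((ENNReal.ofReal_eq_ofReal_iff (by positivity) (abs_nonneg _)).1 h1).symm

theorem abs_det_rpow_one_div (hn : 0 < n) (hc0 : 0 < c)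
    (hL : ∀ x, ‖invMap A x‖ = c * ‖x‖) : |(A.det : ℝ)| ^ (1 / (n : ℝ)) = c⁻¹ := by
  have h1 := abs_det_of_norm_eq hc0 hL
  have h2 : LinearMap.det (invMap A) = ((A.det : ℝ))⁻¹ := by
    have h3 : (A.det : ℝ) = (realMat A).det := (Int.castRingHom ℝ).map_det A
    rw [h3, invMap, Matrix.toEuclideanLin, Matrix.toLpLin_eq_toLin, LinearMap.det_toLin, Matrix.det_nonsing_inv,
      Ring.inverse_eq_inv']
  rw [h2, abs_inv] at h1
  rw [← inv_inv |(A.det : ℝ)|, h1, ← inv_pow, one_div,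
    Real.pow_rpow_inv_natCast (by positivity) hn.ne']

/-! ### Eventually periodic cardinalities -/

theorem prod_range_add_period {e : ℕ → ℕ} {p N : ℕ}
    (hper : ∀ j, p ≤ j → e (j + p) = e j) (hN : ∏ j ∈ Finset.range p, e (p + j) = N) {k : ℕ}
    (hk : p ≤ k) : ∏ j ∈ Finset.range (k + p), e j = (∏ j ∈ Finset.range k, e j) * N := by
  induction k, hk using Nat.le_induction with
  | base => rw [Finset.prod_range_add, hN]
  | succ k hk ih =>
    rw [add_right_comm, Finset.prod_range_succ, ih, Finset.prod_range_succ, hper k hk]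
    ring

/-- A positive sequence that is periodic from some index on is bounded away from `0` and `∞`. -/
theorem exists_bounds_of_eventually_periodic {f : ℕ → ℝ} (hf : ∀ k, 0 < f k) {p : ℕ} (hp : 0 < p)
    (hper : ∀ k, p ≤ k → f (k + p) = f k) :
    ∃ C₁ C₂ : ℝ, 0 < C₁ ∧ ∀ k, C₁ ≤ f k ∧ f k ≤ C₂ := by
  -- Indices below `2 * p` contain the preperiod and one full period.
  have hne : (Finset.range (2 * p)).Nonempty := Finset.nonempty_range_iff.2 (by omega)
  obtain ⟨i, -, hi⟩ := (Finset.range (2 * p)).exists_min_image f hne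
  obtain ⟨j, -, hj⟩ := (Finset.range (2 * p)).exists_max_image f hne
  refine ⟨f i, f j, hf i, fun k => ?_⟩
  induction k using Nat.strong_induction_on with
  | _ k ih =>
    rcases lt_or_ge k (2 * p) with h | h
    · exact ⟨hi k (Finset.mem_range.2 h), hj k (Finset.mem_range.2 h)⟩
    · have h1 := hper (k - p) (by omega)
      rw [Nat.sub_add_cancel (by omega)] at h1
      rw [h1]
      exact ih _ (by omega)

theorem dimH_digitSet_of_eventually_periodic (hA : IsUnit (realMat A)) (hc0 : 0 < c) (hc1 : c < 1)
    (hL : ∀ x, ‖invMap A x‖ = c * ‖x‖) {R : Set (Fin n → ℤ)}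
    (hR : IsCompleteResidueSystem A R) {D : Finset (Fin n → ℤ)}
    (hDR : (D : Set (Fin n → ℤ)) ⊆ R) {E : ℕ → Finset (Fin n → ℤ)}
    (hED : ∀ j, E j ⊆ D) (hne : ∀ j, (E j).Nonempty) {p N : ℕ} (hp : 0 < p)
    (hper : ∀ j, p ≤ j → (E (j + p)).card = (E j).card)
    (hN : ∏ j ∈ Finset.range p, (E (p + j)).card = N) :
    dimH (digitSet A E) = ENNReal.ofReal (Real.log N / (p * Real.log c⁻¹)) := by
  have hN1 : 1 ≤ N := hN ▸ Finset.prod_pos fun j _ => (hne _).card_pos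
  have hN0 : (0 : ℝ) < N := by exact_mod_cast hN1
  have hlog : 0 < Real.log c⁻¹ := Real.log_pos ((one_lt_inv₀ hc0).2 hc1)
  have hp0 : (0 : ℝ) < p := by exact_mod_cast hp
  have hs0 : 0 ≤ Real.log N / (p * Real.log c⁻¹) :=
    div_nonneg (Real.log_natCast_nonneg N) (by positivity)
  set s : ℝ≥0 := (Real.log N / (p * Real.log c⁻¹)).toNNReal with hs
  have hsr : (s : ℝ) = Real.log N / (p * Real.log c⁻¹) := Real.coe_toNNReal _ hs0
  -- This choice of `s` makes `N_k c^(ks)` invariant under `k ↦ k + p` for `k ≥ p`.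
  have hcps : (N : ℝ) * (c ^ p) ^ (s : ℝ) = 1 := by
    have h1 : (c ^ p) ^ (s : ℝ) = (N : ℝ)⁻¹ := by
      rw [Real.rpow_def_of_pos (by positivity), hsr, Real.log_pow, ← Real.exp_log hN0,
        ← Real.exp_neg, Real.log_exp]
      congr 1
      rw [Real.log_inv] at hlog ⊢
      have : Real.log c ≠ 0 := by linarith
      field_simp
    rw [h1, mul_inv_cancel₀ hN0.ne']
  obtain ⟨C₁, C₂, hC₁, hC⟩ := exists_bounds_of_eventually_periodic
    (f := fun k => (∏ j ∈ Finset.range k, ((E j).card : ℝ)) * (c ^ k) ^ (s : ℝ)) (fun k =>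
      mul_pos (Finset.prod_pos fun j _ => by exact_mod_cast (hne j).card_pos) (by positivity)) hp
    (fun k hk => by
      have h1 := prod_range_add_period (e := fun j => (E j).card) hper hN hk
      have h2 : ∏ j ∈ Finset.range (k + p), ((E j).card : ℝ) =
          (∏ j ∈ Finset.range k, ((E j).card : ℝ)) * N := by exact_mod_cast h1
      simp only [h2, pow_add]
      rw [Real.mul_rpow (by positivity) (by positivity), mul_mul_mul_comm, hcps, mul_one])
  exact le_antisymm (dimH_digitSet_le hA hc0 hc1 hL hED fun k => (hC k).2)
    (le_dimH_digitSet hA hc0 hc1 hL hR hDR hED hne hC₁ fun k => (hC k).1)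

end SelfAffine

/-! ### The dimension formula -/

theorem mainTheorem2 (n : ℕ) (hn : 0 < n)
    (A : Matrix (Fin n) (Fin n) ℤ) (hA : IsUnit (SelfAffine.realMat A))
    (hsim : SelfAffine.IsSimilarity (SelfAffine.invMap A))
    (D : Finset (Fin n → ℤ))
    (hD : ∃ R : Set (Fin n → ℤ), SelfAffine.IsCompleteResidueSystem A R ∧ (D : Set (Fin n → ℤ)) ⊆ R)
    (α : EuclideanSpace ℝ (Fin n))
    (a : ℕ → Fin n → ℤ) (ha : SelfAffine.IsRepresentation A (D - D) a α)
    (huniq : ∀ a' : ℕ → Fin n → ℤ, SelfAffine.IsRepresentation A (D - D) a' α → a' = a)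
    (β : ℕ → Fin n → ℤ) (hβ : ∀ j, β j ∈ D)
    (p : ℕ) [NeZero p] (U V : Fin p → Finset (Fin n → ℤ))
    (hSEP : SelfAffine.IsSEPWith (fun j => (D ∩ (D + {a j})) - {β j}) p U V) :
    dimH (SelfAffine.T A D ∩ ((fun x => x + α) '' SelfAffine.T A D)) =
      ENNReal.ofReal
        (Real.log (∏ l : Fin p, ((U l + V l).card : ℝ)) /
          ((p : ℝ) * Real.log (|(A.det : ℝ)| ^ (1 / (n : ℝ))))) := by
  obtain ⟨R, hR, hDR⟩ := hD
  obtain ⟨c, hc0, hc1, hc⟩ := hsim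
  have hL : ∀ x, ‖SelfAffine.invMap A x‖ = c * ‖x‖ := fun x => by
    simpa using hc x 0
  -- Translation by `-β j` does not change cardinality.
  have hcard : ∀ j, p ≤ j → (D ∩ (D + {a j})).card =
      (U (Fin.ofNat p j) + V (Fin.ofNat p j)).card := fun j hj => by
    rw [← hSEP.2 j hj]
    simp only [Finset.sub_singleton]
    rw [Finset.card_image_of_injective _ sub_left_injective]
  rw [SelfAffine.T_inter_image_add_eq_digitSet D α a ha huniq,
    SelfAffine.abs_det_rpow_one_div hn hc0 hL,
    SelfAffine.dimH_digitSet_of_eventually_periodic hA hc0 hc1 hL hR hDR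
      (fun j => Finset.inter_subset_left) (fun j => ?_) (NeZero.pos p) (fun j hj => ?_) rfl]
  · have h : ∀ j ∈ Finset.range p, (D ∩ (D + {a (p + j)})).card =
        (U (Fin.ofNat p j) + V (Fin.ofNat p j)).card := fun j _ => by
      rw [hcard _ (Nat.le_add_right p j)]
      congr 3 <;> simp [Fin.ext_iff]
    rw [Finset.prod_congr rfl h, Finset.prod_range]
    push_cast
    simp
  -- Writing `a j = d - e` with `d, e ∈ D` puts `d` in both `D` and `D + a j`.
  · obtain ⟨d, hd, e, he, h⟩ := Finset.mem_sub.1 (ha.1 j)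
    exact ⟨d, Finset.mem_inter.2 ⟨hd, Finset.mem_add.2 ⟨e, he, a j, Finset.mem_singleton_self _,
      by rw [← h, add_sub_cancel]⟩⟩⟩
  · rw [hcard _ (by omega), hcard _ hj]
    congr 3 <;> simp [Fin.ext_iff]
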